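/- Let $\mathcal D$ be a set (the domain). For a finite set $\Lambda$ of attributes, an attributed relation with scheme $\Lambda$ is a set $P\subseteq\mathcal D^{\Lambda}$; its arity is $|\Lambda|$. A relation $R\subseteq\mathcal D^{n}$ is a subternaric bond when $$R(x_1,\dots,x_n)\iff\exists\,t_1\cdots\exists\,t_k\in\mathcal D\ \big[P_1\land\dots\land P_N\big]$$ for some $k,N\ge 0$, where each factor $P_i$ is an attributed relation of arity $1$, $2$ or $3$ whose scheme is a set of variables among $x_1,\dots,x_n,t_1,\dots,t_k$, such that every free variable $x_j$ occurs in exactly one of the schemes and every bound variable $t_l$ occurs in exactly two of them. The ternarity $\mathrm{ter}(R)\in\{0,1,2,\dots,\infty\}$ is the minimal number of factors of arity $3$ in such representations of $R$, and $\infty$ if there are none. **Theorem.** Let $n\ge 4$ and $m\ge 0$ be integers. For a finite domain $\mathcal D$ consider the share $$s_{n,m}(\mathcal D)=\frac{\big|\{R\subseteq\mathcal D^n:\ \mathrm{ter}(R)\le m\}\big|}{\big|\{R: R\subseteq\mathcal D^n\}\big|}.$$ 1. If $|\mathcal D|\ge 2$ and $|\mathcal D|>\binom{\lfloor (3m+n)/2\rfloor}{n-1}$,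 then $s_{n,m}(\mathcal D)<1$. 2. $s_{n,m}(\mathcal D)\to 0$ as $|\mathcal D|\to\infty$, with $n$ and $m$ fixed. 3. In particular, there are $n$-ary relations of arbitrarily high ternarity: there are a finite domain $\mathcal D$ and a relation $R\subseteq\mathcal D^n$ with $\mathrm{ter}(R)>m$. -/

import Mathlib

/-- An attributed relation on the domain `D` with relation scheme `Λ` (a finite set of attributes):
a set of functions from `Λ` to `D`. Its arity is `Λ.card`. -/
abbrev AttrRel (D : Type*) {A : Type*} (Λ : Finset A) : Type _ := Set (Λ → D)

/-- The natural join of attributed relations whose schemes lie in the attribute set `A`, as a set of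
tuples on all of `A`: the tuples whose subtuple on every scheme belongs to the respective factor.
(It is used for schemes that cover `A`.) -/
def naturalJoin {D A ι : Type*} (Λ : ι → Finset A) (F : ∀ i, AttrRel D (Λ i)) : Set (A → D) :=
  {a | ∀ i, (fun p : Λ i => a p.1) ∈ F i}

/-- A bond with free attributes `S` on the domain `D`: finitely many attributed relations (the
factors) of positive arity, whose attributes are the elements of `S` (free) together with
finitely many parameters (bound). No three schemes share an attribute, every attribute belongs
to some scheme, and the attributes shared by two schemes are exactly the parameters. -/
structure Bond (D S : Type*) where
  /-- the number of parameters -/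
  params : ℕ
  /-- the number of factors -/
  size : ℕ
  /-- the relation schemes of the factors -/
  scheme : Fin size → Finset (S ⊕ Fin params)
  /-- the factors -/
  factor : ∀ i, AttrRel D (scheme i)
  scheme_nonempty : ∀ i, (scheme i).Nonempty
  free_once : ∀ s : S, {i | Sum.inl s ∈ scheme i}.ncard = 1
  bound_twice : ∀ t : Fin params, {i | Sum.inr t ∈ scheme i}.ncard = 2

namespace Bond

/-- The relation represented by a bond: the projection to the free attributes of the natural join
of the factors, i.e. all parameters are existentially quantified. -/
def toRel {D S : Type*} (B : Bond D S) : Set (S → D) :=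
  (fun a : S ⊕ Fin B.params → D => fun s => a (Sum.inl s)) '' naturalJoin B.scheme B.factor

/-- A bond is subternaric when all of its factors have arity at most `3`. -/
def IsSubternaric {D S : Type*} (B : Bond D S) : Prop :=
  ∀ i, (B.scheme i).card ≤ 3

/-- The number of ternary factors of a bond. -/
def numTernaries {D S : Type*} (B : Bond D S) : ℕ :=
  (Finset.univ.filter fun i => (B.scheme i).card = 3).card

end Bond

/-- The ternarity of a relation: the minimal number of ternary factors in its representations as a
subternaric bond, and `⊤` when there are none. -/
noncomputable def ternarity {D S : Type*} (R : Set (S → D)) : ℕ∞ :=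
  sInf {t : ℕ∞ | ∃ B : Bond D S, B.toRel = R ∧ B.IsSubternaric ∧ t = (B.numTernaries : ℕ∞)}

/-- The share of the `n`-ary relations of ternarity at most `m` among all `n`-ary relations on a
finite domain `D`. -/
noncomputable def ternarityShare (D : Type*) (n m : ℕ) : ℝ :=
  ({R : Set (Fin n → D) | ternarity R ≤ (m : ℕ∞)}.ncard : ℝ) / (Nat.card (Set (Fin n → D)) : ℝ)

/-!
Start from a subternaric bond with at most `m` ternary factors. A parameter that lies in a factor of
arity at most `2` can be eliminated by joining that factor with the other one containing the
parameter: the arity of the latter does not grow. When no such parameter is left, either some free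
attribute lies in a factor of arity at most `2`, which has no parameters and splits off, so that `R`
is a product of two relations on complementary sets of attributes; or every attribute lies in a
ternary factor, and counting incidences gives `n + 2k ≤ 3m` for the number `k` of parameters, hence
at most `q = ⌊(3m + n) / 2⌋` attributes in total. Since `n ≥ 4`, all factors have arity at most
`n - 1` in both cases. Padding the schemes and joining the factors on equal schemes, `R` is
determined by one `(n - 1)`-ary relation on each `(n - 1)`-element subset of the `q` attributes.
This leaves at most `2 ^ (C(q, n - 1) |D| ^ (n - 1))` of the `2 ^ (|D| ^ n)` relations. If `3m < n`,
the second case cannot occur, and the diagonal is not a product.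
-/

open scoped Finset

section DependsOn

variable {A B D : Type*} {ι : Sort*}

theorem dependsOn_mem_iff {G : Set (A → D)} {K : Set A} :
    DependsOn (· ∈ G) K ↔ ∀ ⦃a b : A → D⦄, Set.EqOn a b K → a ∈ G → b ∈ G :=
  ⟨fun hG _ _ hab ha => (hG hab).mp ha,
    fun hG _ _ hab => propext ⟨hG hab, hG (Set.EqOn.symm hab)⟩⟩

theorem dependsOn_mem_iInter {G : ι → Set (A → D)} {K : ι → Set A}
    (hG : ∀ i, DependsOn (· ∈ G i) (K i)) : DependsOn (· ∈ ⋂ i, G i) (⋃ i, K i) :=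
  dependsOn_mem_iff.2 fun _ _ hab ha => Set.mem_iInter.2 fun i =>
    dependsOn_mem_iff.1 (hG i) (hab.mono (Set.subset_iUnion K i)) (Set.mem_iInter.1 ha i)

theorem dependsOn_mem_preimage_comp {G : Set (A → D)} {K : Set A}
    (hG : DependsOn (· ∈ G) K) (φ : A → B) :
    DependsOn (· ∈ (fun b : B → D => b ∘ φ) ⁻¹' G) (φ '' K) :=
  fun _ _ hab => hG fun x hx => hab (φ x) (Set.mem_image_of_mem φ hx)

theorem dependsOn_mem_image_comp {G : Set (A → D)} {K : Set A}
    (hG : DependsOn (· ∈ G) K) {φ : B → A} (hφ : φ.Injective) :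
    DependsOn (· ∈ (fun a : A → D => a ∘ φ) '' G) (φ ⁻¹' K) := by
  rw [dependsOn_mem_iff] at hG ⊢
  rintro _ b hgb ⟨g, hg, rfl⟩
  refine ⟨Function.extend φ b g, hG (fun x hx => ?_) hg, Function.extend_comp hφ b g⟩
  by_cases hxφ : ∃ y, φ y = x
  · obtain ⟨y, rfl⟩ := hxφ
    simpa [hφ.extend_apply] using hgb hx
  · simp [Function.extend_apply' _ _ _ hxφ]

theorem image_comp_iInter {φ : B → A} {G : ι → Set (A → D)} {K : ι → Set A}
    {j : ι} (hG : ∀ i ≠ j, DependsOn (· ∈ G i) (K i)) (hK : ∀ i ≠ j, K i ⊆ Set.range φ) :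
    (fun a : A → D => a ∘ φ) '' ⋂ i, G i = ⋂ i, (fun a : A → D => a ∘ φ) '' G i := by
  refine (Set.image_iInter_subset _ _).antisymm fun b hb => ?_
  choose a ha hab using Set.mem_iInter.1 hb
  -- The tuples `a i` all restrict to `b`, so they agree on the range of `φ`.
  refine ⟨a j, Set.mem_iInter.2 fun i => ?_, hab j⟩
  obtain rfl | hij := eq_or_ne i j
  · exact ha i
  · refine dependsOn_mem_iff.1 (hG i hij) (fun x hx => ?_) (ha i)
    obtain ⟨y, rfl⟩ := hK i hij hx
    exact (congrFun (hab i) y).trans (congrFun (hab j) y).symm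

theorem image_comp_inter {φ : B → A} {G H : Set (A → D)} {K : Set A}
    (hG : DependsOn (· ∈ G) K) (hK : K ⊆ Set.range φ) :
    (fun a : A → D => a ∘ φ) '' (G ∩ H) = (fun a => a ∘ φ) '' G ∩ (fun a => a ∘ φ) '' H := by
  rw [Set.inter_eq_iInter, image_comp_iInter (j := false) (K := fun _ => K) (by simpa) (by simpa),
    Set.inter_eq_iInter]
  exact Set.iInter_congr (by simp)

theorem naturalJoin_eq_iInter {ι : Type*} (Λ : ι → Finset A) (F : ∀ i, AttrRel D (Λ i)) :
    naturalJoin Λ F = ⋂ i, {a | (fun p : Λ i => a p.1) ∈ F i} :=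
  Set.ext fun _ => by simp [naturalJoin]

theorem dependsOn_mem_attrRel {Λ : Finset A} (P : AttrRel D Λ) :
    DependsOn (· ∈ {a : A → D | (fun p : Λ => a p.1) ∈ P}) (Λ : Set A) :=
  fun _ _ hab => congrArg (· ∈ P) (funext fun p => hab p.1 p.2)

end DependsOn

/-- A relaxed bond with parameters `Fin k` and factors indexed by `ι`: schemes may be empty and a
parameter may lie in fewer than two of them, so that factors can be merged and parameters
eliminated. A factor is encoded as a set of tuples on all attributes that depends only on its
scheme. -/
structure Network (D S : Type*) (k : ℕ) (ι : Type*) where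
  /-- the relation schemes of the factors -/
  scheme : ι → Finset (S ⊕ Fin k)
  /-- the factors -/
  factor : ι → Set (S ⊕ Fin k → D)
  factor_dependsOn : ∀ i, DependsOn (· ∈ factor i) (scheme i : Set (S ⊕ Fin k))
  free_once : ∀ s, ∃! i, Sum.inl s ∈ scheme i
  bound_at_most_twice : ∀ t i j l, Sum.inr t ∈ scheme i → Sum.inr t ∈ scheme j →
    Sum.inr t ∈ scheme l → i = j ∨ i = l ∨ j = l

namespace Network

variable {D S ι : Type*} {k : ℕ}

/-- The relation represented by a network: the projection of the join of its factors to the free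
attributes. -/
def toRel (W : Network D S k ι) : Set (S → D) :=
  (fun a : S ⊕ Fin k → D => a ∘ Sum.inl) '' ⋂ i, W.factor i

/-- The number of ternary factors of a network. -/
def numTernaries [Fintype ι] (W : Network D S k ι) : ℕ :=
  #{i | #(W.scheme i) = 3}

/-- A network is reduced when every parameter is shared by two factors and lies only in ternary
factors. -/
def IsReduced (W : Network D S k ι) : Prop :=
  ∀ t, (∃ i j, i ≠ j ∧ Sum.inr t ∈ W.scheme i ∧ Sum.inr t ∈ W.scheme j) ∧
    ∀ i, Sum.inr t ∈ W.scheme i → #(W.scheme i) = 3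

theorem numTernaries_le_of_card_scheme_le [Fintype ι] {k' : ℕ} {W : Network D S k ι}
    {W' : Network D S k' ι} (hcard : ∀ i, #(W'.scheme i) ≤ #(W.scheme i))
    (hW : ∀ i, #(W.scheme i) ≤ 3) : W'.numTernaries ≤ W.numTernaries := by
  refine Finset.card_le_card fun i hi => ?_
  rw [Finset.mem_filter_univ] at hi ⊢
  exact (hW i).antisymm (hi ▸ hcard i)

open scoped Classical in
/-- Joins the factor `i` into the factor `j`, leaving a trivial factor with empty scheme at `i`. -/
noncomputable def merge (W : Network D S k ι) {i j : ι} (hij : i ≠ j) : Network D S k ι where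
  scheme l := if l = j then W.scheme i ∪ W.scheme j else if l = i then ∅ else W.scheme l
  factor l := if l = j then W.factor i ∩ W.factor j else if l = i then Set.univ else W.factor l
  factor_dependsOn l := by
    rw [dependsOn_mem_iff]
    intro a b hab ha
    have hW l := dependsOn_mem_iff.1 (W.factor_dependsOn l)
    split_ifs at hab ha ⊢ with hlj hli
    · rw [Finset.coe_union] at hab
      exact ⟨hW i (hab.mono Set.subset_union_left) ha.1,
        hW j (hab.mono Set.subset_union_right) ha.2⟩
    · trivial
    · exact hW l hab ha
  free_once s := by
    obtain ⟨l, hl, hunique⟩ := W.free_once s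
    by_cases hli : l = i
    · exact ⟨j, by grind, by grind⟩
    · exact ⟨l, by grind, by grind⟩
  bound_at_most_twice t := by
    have := W.bound_at_most_twice t
    grind

theorem toRel_merge (W : Network D S k ι) {i j : ι} (hij : i ≠ j) :
    (W.merge hij).toRel = W.toRel := by
  have hfactors : ⋂ l, (W.merge hij).factor l = ⋂ l, W.factor l := by
    ext a
    simp only [merge, Set.mem_iInter]
    refine ⟨fun ha l => ?_, by grind⟩
    have hj := ha j
    have hl := ha l
    grind
  rw [toRel, hfactors, toRel]

/-- Existentially quantifies the parameter `t` in each factor separately. This preserves the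
represented relation only if at most one scheme contains `t`. -/
noncomputable def eliminate (W : Network D S (k + 1) ι) (t : Fin (k + 1)) : Network D S k ι where
  scheme l := (W.scheme l).preimage (Sum.map id t.succAbove)
    (Function.injective_id.sumMap t.succAbove_right_injective).injOn
  factor l := (fun a : S ⊕ Fin (k + 1) → D => a ∘ Sum.map id t.succAbove) '' W.factor l
  factor_dependsOn l := by
    rw [Finset.coe_preimage]
    exact dependsOn_mem_image_comp (W.factor_dependsOn l)
      (Function.injective_id.sumMap t.succAbove_right_injective)
  free_once s := by simpa using W.free_once s
  bound_at_most_twice u := by simpa using W.bound_at_most_twice (t.succAbove u)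

theorem toRel_eliminate (W : Network D S (k + 1) ι) {t : Fin (k + 1)} (j : ι)
    (ht : ∀ l ≠ j, Sum.inr t ∉ W.scheme l) : (W.eliminate t).toRel = W.toRel := by
  have hrange : ∀ l ≠ j, 
      (W.scheme l : Set (S ⊕ Fin (k + 1))) ⊆ Set.range (Sum.map id t.succAbove) := by
    rintro l hl (s | u) hx
    · exact ⟨Sum.inl s, rfl⟩
    · obtain ⟨v, rfl⟩ := Fin.exists_succAbove_eq fun hut : u = t => ht l hl (hut ▸ hx)
      exact ⟨Sum.inr v, rfl⟩
  simp only [toRel, eliminate]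
  rw [← image_comp_iInter (fun l _ => W.factor_dependsOn l) hrange, Set.image_image]
  rfl

theorem card_scheme_eliminate_le (W : Network D S (k + 1) ι) (t : Fin (k + 1)) (l : ι) :
    #((W.eliminate t).scheme l) ≤ #(W.scheme l) := by
  classical
  rw [eliminate, Finset.card_preimage]
  exact Finset.card_filter_le _ _

theorem card_scheme_eliminate_lt (W : Network D S (k + 1) ι) {t : Fin (k + 1)} {l : ι}
    (ht : Sum.inr t ∈ W.scheme l) : #((W.eliminate t).scheme l) < #(W.scheme l) := by
  classical
  rw [eliminate, Finset.card_preimage]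
  exact Finset.card_lt_card (Finset.filter_ssubset.2 ⟨_, ht, by simp [Fin.succAbove_ne]⟩)

-- The two schemes share `t`, which counts twice in the sum of their arities and is then
-- eliminated, so absorbing a factor of arity at most `2` does not enlarge the other one.
theorem card_scheme_eliminate_merge_le (W : Network D S (k + 1) ι) {t : Fin (k + 1)} {i j : ι}
    (hij : i ≠ j) (hi : Sum.inr t ∈ W.scheme i) (hj : Sum.inr t ∈ W.scheme j)
    (hi2 : #(W.scheme i) ≤ 2) (l : ι) :
    #(((W.merge hij).eliminate t).scheme l) ≤ #(W.scheme l) := by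
  classical
  obtain rfl | hlj := eq_or_ne l j
  · have hscheme : (W.merge hij).scheme l = W.scheme i ∪ W.scheme l := by simp [merge]
    have hlt := (W.merge hij).card_scheme_eliminate_lt (t := t) (l := l)
      (hscheme ▸ Finset.mem_union_left _ hi)
    have hinter : 0 < #(W.scheme i ∩ W.scheme l) :=
      Finset.card_pos.2 ⟨_, Finset.mem_inter.2 ⟨hi, hj⟩⟩
    have hunion := Finset.card_union_add_card_inter (W.scheme i) (W.scheme l)
    rw [hscheme] at hlt
    omega
  · refine ((W.merge hij).card_scheme_eliminate_le t l).trans ?_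
    simp only [merge, if_neg hlj]
    split_ifs <;> simp

theorem exists_fewer_params_of_not_isReduced [Nonempty S] (W : Network D S (k + 1) ι)
    (hW : ∀ i, #(W.scheme i) ≤ 3) (hred : ¬ W.IsReduced) :
    ∃ W' : Network D S k ι, W'.toRel = W.toRel ∧ ∀ i, #(W'.scheme i) ≤ #(W.scheme i) := by
  obtain ⟨t, ht⟩ := not_forall.1 hred
  by_cases hshared : ∃ i j, i ≠ j ∧ Sum.inr t ∈ W.scheme i ∧ Sum.inr t ∈ W.scheme j
  · obtain ⟨i, j, hij, hi, hj, hi2⟩ : ∃ i j, i ≠ j ∧ Sum.inr t ∈ W.scheme i ∧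
        Sum.inr t ∈ W.scheme j ∧ #(W.scheme i) ≤ 2 := by
      grind
    refine ⟨(W.merge hij).eliminate t, ?_, W.card_scheme_eliminate_merge_le hij hi hj hi2⟩
    rw [toRel_eliminate _ j, toRel_merge]
    have := W.bound_at_most_twice t
    grind [merge]
  · have : Nonempty ι := (W.free_once (Classical.arbitrary S)).exists.nonempty
    obtain ⟨j, hj⟩ : ∃ j, ∀ l ≠ j, Sum.inr t ∉ W.scheme l := by
      by_cases hused : ∃ j, Sum.inr t ∈ W.scheme j
      · obtain ⟨j, hj⟩ := hused
        exact ⟨j, fun l hlj hl => hshared ⟨l, j, hlj, hl, hj⟩⟩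
      · exact ⟨Classical.arbitrary ι, fun l _ hl => hused ⟨l, hl⟩⟩
    exact ⟨W.eliminate t, W.toRel_eliminate j hj, W.card_scheme_eliminate_le t⟩

theorem exists_isReduced [Nonempty S] (W : Network D S k ι) (hW : ∀ i, #(W.scheme i) ≤ 3) :
    ∃ (k' : ℕ) (W' : Network D S k' ι), W'.IsReduced ∧ W'.toRel = W.toRel ∧
      ∀ i, #(W'.scheme i) ≤ #(W.scheme i) := by
  induction k with
  | zero => exact ⟨0, W, fun t => t.elim0, rfl, fun _ => le_rfl⟩
  | succ k ih =>
    by_cases hred : W.IsReduced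
    · exact ⟨k + 1, W, hred, rfl, fun _ => le_rfl⟩
    · obtain ⟨V, hVrel, hVcard⟩ := W.exists_fewer_params_of_not_isReduced hW hred
      obtain ⟨k', W', hW', hrel, hcard⟩ := ih V fun i => (hVcard i).trans (hW i)
      exact ⟨k', W', hW', hrel.trans hVrel, fun i => (hcard i).trans (hVcard i)⟩

theorem IsReduced.card_add_two_mul_le [Fintype S] [Fintype ι] {W : Network D S k ι}
    (hW : W.IsReduced) (hfree : ∀ s i, Sum.inl s ∈ W.scheme i → #(W.scheme i) = 3) :
    Fintype.card S + 2 * k ≤ 3 * W.numTernaries := by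
  classical
  let E : Finset ι := {i | #(W.scheme i) = 3}
  have hfree_pos (s : S) : 1 ≤ #{i ∈ E | Sum.inl s ∈ W.scheme i} := by
    obtain ⟨i, hi⟩ := (W.free_once s).exists
    exact Finset.card_pos.2 ⟨i, by simp [E, hi, hfree s i hi]⟩
  have hbound_two (t : Fin k) : 2 ≤ #{i ∈ E | Sum.inr t ∈ W.scheme i} := by
    obtain ⟨⟨i, j, hij, hi, hj⟩, hcard⟩ := hW t
    exact Finset.one_lt_card.2
      ⟨i, by simp [E, hi, hcard i hi], j, by simp [E, hj, hcard j hj], hij⟩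
  calc Fintype.card S + 2 * k = ∑ _s : S, 1 + ∑ _t : Fin k, 2 := by simp [mul_comm]
    _ ≤ ∑ s : S, #{i ∈ E | Sum.inl s ∈ W.scheme i} +
          ∑ t : Fin k, #{i ∈ E | Sum.inr t ∈ W.scheme i} :=
        add_le_add (Finset.sum_le_sum fun s _ => hfree_pos s)
          (Finset.sum_le_sum fun t _ => hbound_two t)
    _ = ∑ x, #{i ∈ E | x ∈ W.scheme i} :=
        (Fintype.sum_sum_type fun x => #{i ∈ E | x ∈ W.scheme i}).symm
    _ = ∑ i ∈ E, #{x | x ∈ W.scheme i} :=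
        (Finset.sum_card_bipartiteAbove_eq_sum_card_bipartiteBelow _).symm
    _ = 3 * W.numTernaries := by
        simp only [Finset.filter_univ_mem]
        rw [Finset.sum_const_nat fun i hi => (Finset.mem_filter_univ i).1 hi, mul_comm,
          numTernaries]

theorem IsReduced.toRel_eq_inter {W : Network D S k ι} (hW : W.IsReduced) {s : S} {i : ι}
    (hs : Sum.inl s ∈ W.scheme i) (hi : #(W.scheme i) ≠ 3) :
    ∃ (I : Finset S) (P Q : Set (S → D)), I.Nonempty ∧ #I ≤ #(W.scheme i) ∧
      DependsOn (· ∈ P) (I : Set S) ∧ DependsOn (· ∈ Q) (I : Set S)ᶜ ∧ W.toRel = P ∩ Q := by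
  classical
  have hno_param : (W.scheme i : Set _) ⊆ Set.range (Sum.inl : S → S ⊕ Fin k) := by
    rintro (x | t) hx
    · exact ⟨x, rfl⟩
    · exact absurd ((hW t).2 i hx) hi
  let rest : Set (S ⊕ Fin k → D) := ⋂ (l) (_ : l ≠ i), W.factor l
  have hrest : DependsOn (· ∈ rest) (⋃ (l) (_ : l ≠ i), (W.scheme l : Set (S ⊕ Fin k))) :=
    dependsOn_mem_iInter fun l => dependsOn_mem_iInter fun _ => W.factor_dependsOn l
  refine ⟨(W.scheme i).preimage Sum.inl Sum.inl_injective.injOn,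
    (fun a => a ∘ Sum.inl) '' W.factor i, (fun a => a ∘ Sum.inl) '' rest,
    ⟨s, Finset.mem_preimage.2 hs⟩, ?_, ?_, ?_, ?_⟩
  · rw [Finset.card_preimage]
    exact Finset.card_filter_le _ _
  · rw [Finset.coe_preimage]
    exact dependsOn_mem_image_comp (W.factor_dependsOn i) Sum.inl_injective
  · refine (dependsOn_mem_image_comp hrest Sum.inl_injective).mono fun x hx hxi => ?_
    obtain ⟨l, hli, hl⟩ := Set.mem_iUnion₂.1 hx
    exact hli ((W.free_once x).unique hl (Finset.mem_preimage.1 hxi))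
  · have hsplit : ⋂ l, W.factor l = W.factor i ∩ rest := iInf_split_single _ i
    rw [toRel, hsplit, image_comp_inter (W.factor_dependsOn i) hno_param]

end Network

/-- A bond seen as a network: its factors become sets of tuples on all attributes. -/
def Bond.toNetwork {D S : Type*} (B : Bond D S) : Network D S B.params (Fin B.size) where
  scheme := B.scheme
  factor i := {a | (fun p : B.scheme i => a p.1) ∈ B.factor i}
  factor_dependsOn i := dependsOn_mem_attrRel (B.factor i)
  free_once s := by
    obtain ⟨i, hi⟩ := Set.ncard_eq_one.1 (B.free_once s)
    exact ⟨i, (Set.ext_iff.1 hi i).2 rfl, fun j hj => (Set.ext_iff.1 hi j).1 hj⟩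
  bound_at_most_twice t i j l hi hj hl := by
    obtain ⟨x, y, -, hxy⟩ := Set.ncard_eq_two.1 (B.bound_twice t)
    have hmem (i) : Sum.inr t ∈ B.scheme i ↔ i = x ∨ i = y := Set.ext_iff.1 hxy i
    grind

theorem Bond.toRel_toNetwork {D S : Type*} (B : Bond D S) : B.toNetwork.toRel = B.toRel := by
  rw [Bond.toRel, naturalJoin_eq_iInter]
  rfl

theorem exists_bond_of_ternarity_le {D S : Type*} {R : Set (S → D)} {m : ℕ}
    (hR : ternarity R ≤ m) :
    ∃ B : Bond D S, B.toRel = R ∧ B.IsSubternaric ∧ B.numTernaries ≤ m := by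
  have hne : {t : ℕ∞ | ∃ B : Bond D S, B.toRel = R ∧ B.IsSubternaric ∧
      t = (B.numTernaries : ℕ∞)}.Nonempty := by
    by_contra hempty
    rw [ternarity, Set.not_nonempty_iff_eq_empty.1 hempty, sInf_empty, top_le_iff] at hR
    exact ENat.natCast_ne_top m hR
  obtain ⟨B, hBR, hB, hm⟩ := csInf_mem hne
  exact ⟨B, hBR, hB, by rwa [ternarity, hm, Nat.cast_le] at hR⟩

theorem exists_network_or_eq_inter_of_ternarity_le {D S : Type*} [Fintype S] [Nonempty S]
    {R : Set (S → D)} {m : ℕ} (hR : ternarity R ≤ m) :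
    (∃ (k N : ℕ) (W : Network D S k (Fin N)), W.toRel = R ∧ (∀ i, #(W.scheme i) ≤ 3) ∧
      Fintype.card S + 2 * k ≤ 3 * m) ∨
    ∃ (I : Finset S) (P Q : Set (S → D)), I.Nonempty ∧ #I ≤ 2 ∧
      DependsOn (· ∈ P) (I : Set S) ∧ DependsOn (· ∈ Q) (I : Set S)ᶜ ∧ R = P ∩ Q := by
  obtain ⟨B, rfl, hB, hm⟩ := exists_bond_of_ternarity_le hR
  obtain ⟨k, W, hred, hrel, hcard⟩ := B.toNetwork.exists_isReduced hB
  have hW i : #(W.scheme i) ≤ 3 := (hcard i).trans (hB i)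
  rw [B.toRel_toNetwork] at hrel
  by_cases hfree : ∀ s i, Sum.inl s ∈ W.scheme i → #(W.scheme i) = 3
  · refine .inl ⟨k, _, W, hrel, hW, (hred.card_add_two_mul_le hfree).trans ?_⟩
    exact Nat.mul_le_mul_left 3 ((Network.numTernaries_le_of_card_scheme_le hcard hB).trans hm)
  · push Not at hfree
    obtain ⟨s, i, hs, hi⟩ := hfree
    obtain ⟨I, P, Q, hI, hIcard, hP, hQ, heq⟩ := hred.toRel_eq_inter hs hi
    exact .inr ⟨I, P, Q, hI, by have := hW i; omega, hP, hQ, hrel.symm.trans heq⟩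

section ProjectedJoins

variable {A D S T : Type*} {r : ℕ}

theorem exists_naturalJoin_eq_iInter [Fintype A] {ι : Type*} {G : ι → Set (A → D)}
    {L : ι → Finset A} (hr : r ≤ Fintype.card A)
    (hG : ∀ i, DependsOn (· ∈ G i) (L i : Set A)) (hL : ∀ i, #(L i) ≤ r) :
    ∃ F : ∀ K : {K : Finset A // #K = r}, AttrRel D K.1,
      naturalJoin Subtype.val F = ⋂ i, G i := by
  refine ⟨fun K => (fun a p => a p.1) '' ⋂ (i) (_ : L i ⊆ K.1), G i, ?_⟩
  refine Set.Subset.antisymm (fun a ha => Set.mem_iInter.2 fun i => ?_) fun a ha K => ?_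
  · obtain ⟨K, hLK, hK⟩ := Finset.exists_superset_card_eq (hL i) hr
    obtain ⟨b, hb, hba⟩ := ha ⟨K, hK⟩
    exact dependsOn_mem_iff.1 (hG i) (fun x hx => congrFun hba ⟨x, hLK hx⟩)
      (Set.mem_iInter₂.1 hb i hLK)
  · exact ⟨a, Set.mem_iInter₂.2 fun i _ => Set.mem_iInter.1 ha i, rfl⟩

/-- The relations on the attributes `S` that are projections of joins of `r`-ary factors on the
attributes `S ⊕ T`, with one factor for each `r`-element set of attributes. -/
def projectedJoins (D S T : Type*) (r : ℕ) : Set (Set (S → D)) :=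
  Set.range fun F : ∀ K : {K : Finset (S ⊕ T) // #K = r}, AttrRel D K.1 =>
    (fun a : S ⊕ T → D => a ∘ Sum.inl) '' naturalJoin Subtype.val F

theorem image_iInter_mem_projectedJoins [Fintype S] [Fintype T] {ι : Type*}
    {G : ι → Set (S ⊕ T → D)} {L : ι → Finset (S ⊕ T)} (hr : r ≤ Fintype.card (S ⊕ T))
    (hG : ∀ i, DependsOn (· ∈ G i) (L i : Set (S ⊕ T))) (hL : ∀ i, #(L i) ≤ r) :
    (fun a : S ⊕ T → D => a ∘ Sum.inl) '' ⋂ i, G i ∈ projectedJoins D S T r := by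
  obtain ⟨F, hF⟩ := exists_naturalJoin_eq_iInter hr hG hL
  exact ⟨F, congrArg _ hF⟩

theorem projectedJoins_subset_of_embedding [Fintype S] [Nonempty S] {T' : Type*} [Fintype T']
    (hr : r ≤ Fintype.card (S ⊕ T')) (f : T ↪ T') :
    projectedJoins D S T r ⊆ projectedJoins D S T' r := by
  classical
  rintro _ ⟨F, rfl⟩
  let φ : S ⊕ T → S ⊕ T' := Sum.map id f
  have hφ : φ.Injective := Function.injective_id.sumMap f.injective
  have himage (X : Set (S ⊕ T → D)) : (fun a : S ⊕ T → D => a ∘ Sum.inl) '' X =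
      (fun b : S ⊕ T' → D => b ∘ Sum.inl) '' ((fun b => b ∘ φ) ⁻¹' X) := by
    rcases isEmpty_or_nonempty D with hD | hD
    · exact Subsingleton.elim _ _
    · conv_lhs => rw [← Set.image_preimage_eq X hφ.surjective_comp_right, Set.image_image]
      rfl
  beta_reduce
  rw [himage, naturalJoin_eq_iInter, Set.preimage_iInter]
  refine image_iInter_mem_projectedJoins (L := fun K => K.1.image φ) hr (fun K => ?_) fun K => ?_
  · rw [Finset.coe_image]
    exact dependsOn_mem_preimage_comp (dependsOn_mem_attrRel (F K)) φ
  · exact Finset.card_image_le.trans K.2.le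

theorem inter_mem_projectedJoins [Fintype S] [IsEmpty T] {P Q : Set (S → D)}
    {I J : Finset S} (hr : r ≤ Fintype.card S) (hP : DependsOn (· ∈ P) (I : Set S))
    (hQ : DependsOn (· ∈ Q) (J : Set S)) (hI : #I ≤ r) (hJ : #J ≤ r) :
    P ∩ Q ∈ projectedJoins D S T r := by
  have : Fintype T := Fintype.ofIsEmpty
  have hsurj : (fun a : S ⊕ T → D => a ∘ Sum.inl).Surjective :=
    fun s => ⟨Sum.elim s isEmptyElim, rfl⟩
  rw [← Set.image_preimage_eq (P ∩ Q) hsurj, Set.inter_eq_iInter, Set.preimage_iInter]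
  refine image_iInter_mem_projectedJoins
    (L := fun b => (cond b I J).map Function.Embedding.inl) (hr.trans (by simp)) ?_ ?_
  · rintro (_ | _) <;> rw [Finset.coe_map]
    · exact dependsOn_mem_preimage_comp hQ Sum.inl
    · exact dependsOn_mem_preimage_comp hP Sum.inl
  · rintro (_ | _) <;> rwa [Finset.card_map]

theorem card_set_arrow (D A : Type*) [Finite D] [Finite A] :
    Nat.card (Set (A → D)) = 2 ^ Nat.card D ^ Nat.card A := by
  rw [Set, Nat.card_fun, Nat.card_fun]
  simp

theorem ncard_projectedJoins_le [Finite D] [Fintype S] [Fintype T] :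
    (projectedJoins D S T r).ncard ≤
      2 ^ ((Fintype.card S + Fintype.card T).choose r * Nat.card D ^ r) := by
  classical
  calc (projectedJoins D S T r).ncard
      ≤ Nat.card (∀ K : {K : Finset (S ⊕ T) // #K = r}, AttrRel D K.1) :=
        Finite.card_range_le _
    _ = ∏ _K : {K : Finset (S ⊕ T) // #K = r}, 2 ^ Nat.card D ^ r := by
        rw [Nat.card_pi]
        refine Finset.prod_congr rfl fun K _ => ?_
        rw [card_set_arrow, Nat.card_eq_finsetCard, K.2]
    _ = 2 ^ ((Fintype.card S + Fintype.card T).choose r * Nat.card D ^ r) := by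
        rw [Finset.prod_const, Finset.card_univ, Fintype.card_finset_len, Fintype.card_sum,
          ← pow_mul, mul_comm]

end ProjectedJoins

theorem mem_projectedJoins_of_ternarity_le {D S : Type*} [Fintype S] {R : Set (S → D)} {m p : ℕ}
    (hS : 4 ≤ Fintype.card S) (hp : 3 * m ≤ Fintype.card S + 2 * p + 1) (hR : ternarity R ≤ m) :
    R ∈ projectedJoins D S (Fin p) (Fintype.card S - 1) := by
  classical
  have : Nonempty S := Fintype.card_pos_iff.1 (by omega)
  have hr : Fintype.card S - 1 ≤ Fintype.card (S ⊕ Fin p) := by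
    rw [Fintype.card_sum]
    omega
  obtain ⟨k, N, W, rfl, hW, hk⟩ | ⟨I, P, Q, hI, hI2, hP, hQ, rfl⟩ :=
    exists_network_or_eq_inter_of_ternarity_le hR
  · refine projectedJoins_subset_of_embedding hr (Fin.castLEEmb (n := k) (by omega)) ?_
    refine image_iInter_mem_projectedJoins ?_ W.factor_dependsOn fun i => (hW i).trans (by omega)
    rw [Fintype.card_sum]
    omega
  · refine projectedJoins_subset_of_embedding hr (Fin.castLEEmb (n := 0) p.zero_le) ?_
    rw [← Finset.coe_compl] at hQ
    refine inter_mem_projectedJoins (Nat.sub_le _ _) hP hQ (by omega) ?_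
    rw [Finset.card_compl]
    have := hI.card_pos
    omega

theorem ncard_setOf_ternarity_le {D S : Type*} [Finite D] [Fintype S] {m p : ℕ}
    (hS : 4 ≤ Fintype.card S) (hp : 3 * m ≤ Fintype.card S + 2 * p + 1) :
    {R : Set (S → D) | ternarity R ≤ m}.ncard ≤
      2 ^ ((Fintype.card S + p).choose (Fintype.card S - 1) *
        Nat.card D ^ (Fintype.card S - 1)) :=
  calc {R : Set (S → D) | ternarity R ≤ m}.ncard
      ≤ (projectedJoins D S (Fin p) (Fintype.card S - 1)).ncard :=
        Set.ncard_le_ncard fun _ hR => mem_projectedJoins_of_ternarity_le hS hp hR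
    _ ≤ _ := by simpa using ncard_projectedJoins_le (D := D) (S := S) (T := Fin p)

theorem range_const_ne_inter {D S : Type*} [Nontrivial D] {I : Set S} (hI : I.Nonempty)
    (hI' : Iᶜ.Nonempty) {P Q : Set (S → D)} (hP : DependsOn (· ∈ P) I)
    (hQ : DependsOn (· ∈ Q) Iᶜ) : Set.range (Function.const S) ≠ P ∩ Q := by
  classical
  intro heq
  obtain ⟨u, v, huv⟩ := exists_pair_ne D
  have hu : Function.const S u ∈ P ∩ Q := heq ▸ Set.mem_range_self u
  have hv : Function.const S v ∈ P ∩ Q := heq ▸ Set.mem_range_self v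
  obtain ⟨w, hw⟩ : I.piecewise (Function.const S u) (Function.const S v) ∈
      Set.range (Function.const S) :=
    heq ▸ ⟨dependsOn_mem_iff.1 hP (Set.piecewise_eqOn I _ _).symm hu.1,
      dependsOn_mem_iff.1 hQ (Set.piecewise_eqOn_compl I _ _).symm hv.2⟩
  obtain ⟨x, hx⟩ := hI
  obtain ⟨y, hy⟩ := hI'
  have hwu : w = u := by simpa [hx] using congrFun hw x
  have hwv : w = v := by simpa [show y ∉ I from hy] using congrFun hw y
  exact huv (hwu.symm.trans hwv)

theorem lt_ternarity_range_const {D S : Type*} [Nontrivial D] [Fintype S] {m : ℕ}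
    (hS : 3 ≤ Fintype.card S) (hm : 3 * m < Fintype.card S) :
    (m : ℕ∞) < ternarity (Set.range (Function.const S) : Set (S → D)) := by
  have : Nonempty S := Fintype.card_pos_iff.1 (by omega)
  refine not_le.1 fun hle => ?_
  obtain ⟨_, _, _, -, -, hk⟩ | ⟨I, P, Q, hI, hI2, hP, hQ, heq⟩ :=
    exists_network_or_eq_inter_of_ternarity_le hle
  · omega
  · refine range_const_ne_inter hI ?_ hP hQ heq
    obtain ⟨y, hy⟩ := Finset.exists_mem_notMem_of_card_lt_card
      (s := I) (t := Finset.univ) (by rw [Finset.card_univ]; omega)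
    exact ⟨y, by simpa using hy⟩

theorem ternarityShare_lt_one_iff {D : Type*} [Finite D] {n m : ℕ} :
    ternarityShare D n m < 1 ↔ ∃ R : Set (Fin n → D), (m : ℕ∞) < ternarity R := by
  have hpos : (0 : ℝ) < Nat.card (Set (Fin n → D)) := mod_cast Nat.card_pos
  rw [ternarityShare, div_lt_one hpos, Nat.cast_lt, (Set.ncard_le_card _).lt_iff_ne,
    Ne, ← Set.eq_univ_iff_ncard, ← Ne, Set.ne_univ_iff_exists_notMem]
  simp

theorem ternarityShare_le_half_pow {D : Type*} [Finite D] {n m p k : ℕ} (hn : 4 ≤ n)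
    (hp : 3 * m ≤ n + 2 * p + 1) (hk : (n + p).choose (n - 1) + k ≤ Nat.card D) :
    ternarityShare D n m ≤ (1 / 2) ^ (k * Nat.card D ^ (n - 1)) := by
  set d := Nat.card D
  have hncard : {R : Set (Fin n → D) | ternarity R ≤ m}.ncard ≤
      2 ^ ((n + p).choose (n - 1) * d ^ (n - 1)) := by
    simpa using ncard_setOf_ternarity_le (D := D) (S := Fin n) (p := p) (by simpa) (by simpa)
  have hexp : (n + p).choose (n - 1) * d ^ (n - 1) + k * d ^ (n - 1) ≤ d ^ n := by
    rw [← add_mul, ← mul_pow_sub_one (by omega : n ≠ 0) d]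
    gcongr
  rw [ternarityShare, card_set_arrow, Nat.card_fin, one_div_pow, div_le_div_iff₀ (by positivity)
    (by positivity), one_mul]
  norm_cast
  calc _ ≤ 2 ^ ((n + p).choose (n - 1) * d ^ (n - 1)) * 2 ^ (k * d ^ (n - 1)) := by gcongr
    _ ≤ 2 ^ d ^ n := by rw [← pow_add]; gcongr; exact one_le_two

theorem ternarityShare_lt_one {D : Type*} [Finite D] {n m : ℕ} (hn : 4 ≤ n)
    (hD : 2 ≤ Nat.card D) (hchoose : ((3 * m + n) / 2).choose (n - 1) < Nat.card D) :
    ternarityShare D n m < 1 := by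
  obtain hm | hm := le_or_gt n (3 * m)
  · have hq : n + (3 * m - n) / 2 = (3 * m + n) / 2 := by omega
    refine (ternarityShare_le_half_pow (k := 1) (p := (3 * m - n) / 2) hn (by omega) ?_).trans_lt
      (pow_lt_one₀ (by norm_num) (by norm_num) (by positivity))
    rwa [hq]
  · have : Nontrivial D := Finite.one_lt_card_iff_nontrivial.1 hD
    exact ternarityShare_lt_one_iff.2
      ⟨_, lt_ternarity_range_const (by rw [Fintype.card_fin]; omega) (by rwa [Fintype.card_fin])⟩

theorem exists_forall_ternarityShare_lt {n : ℕ} (hn : 4 ≤ n) (m : ℕ) {ε : ℝ} (hε : 0 < ε) :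
    ∃ N : ℕ, ∀ (D : Type*) [Finite D], N ≤ Nat.card D → ternarityShare D n m < ε := by
  obtain ⟨k, hk⟩ := exists_pow_lt_of_lt_one hε (by norm_num : (1 / 2 : ℝ) < 1)
  refine ⟨(n + 3 * m).choose (n - 1) + k + 1, fun D _ hN => ?_⟩
  have hD : 0 < Nat.card D := by omega
  calc ternarityShare D n m ≤ (1 / 2) ^ (k * Nat.card D ^ (n - 1)) :=
        ternarityShare_le_half_pow (p := 3 * m) hn (by omega) (by omega)
    _ ≤ (1 / 2) ^ k := pow_le_pow_of_le_one (by norm_num) (by norm_num)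
        (Nat.le_mul_of_pos_right k (pow_pos hD _))
    _ < ε := hk

theorem mainTheorem6 (n : ℕ) (hn : 4 ≤ n) (m : ℕ) :
    (∀ (D : Type*) [Finite D], 2 ≤ Nat.card D →
      Nat.choose ((3 * m + n) / 2) (n - 1) < Nat.card D → ternarityShare D n m < 1) ∧
    (∀ ε : ℝ, 0 < ε → ∃ N : ℕ, ∀ (D : Type*) [Finite D], N ≤ Nat.card D →
      ternarityShare D n m < ε) ∧
    (∃ (d : ℕ) (R : Set (Fin n → Fin d)), (m : ℕ∞) < ternarity R) := by
  refine ⟨fun D _ => ternarityShare_lt_one hn,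
    fun ε hε => exists_forall_ternarityShare_lt hn m hε, ?_⟩
  obtain ⟨N, hN⟩ := exists_forall_ternarityShare_lt hn m one_pos
  exact ⟨N, ternarityShare_lt_one_iff.1 (hN (Fin N) (by simp))⟩
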